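/- **Theorem 2.1.** Let $\mathbf x_0\in\mathbb R^3$, let $\mathbf a\in\mathbb R^3$ be a unit vector, and let $\theta_0\in(0,\pi/2)$, $r_0>0$, $\omega,\varepsilon_0,\mu_0>0$ and $\alpha\in(0,1)$. Let $$\mathcal K=\{\mathbf x\in\mathbb R^3\setminus\{\mathbf x_0\} : \text{the angle between } \mathbf x-\mathbf x_0 \text{ and } \mathbf a \text{ is less than } \theta_0\}$$ be the open convex circular cone with apex $\mathbf x_0$, axis $\mathbf a$ and opening angle $2\theta_0$, and let $\mathcal K_{r_0}=\mathcal K\cap B_{r_0}(\mathbf x_0)$, where $B_{r_0}(\mathbf x_0)=\{\mathbf x:|\mathbf x-\mathbf x_0|<r_0\}$. Let $\mathbf J_1,\mathbf J_2\in C^\alpha(\overline{\mathcal K_{r_0}})^3$ be $\mathbb C^3$-valued, and let $\mathbf E,\mathbf H\in H(\mathrm{curl},\mathcal K_{r_0})$, that is, $\mathbf E,\mathbf H\in L^2(\mathcal K_{r_0};\mathbb C^3)$ with distributional curls in $L^2(\mathcal K_{r_0};\mathbb C^3)$. Suppose that $$\begin{cases}\nabla\wedge\mathbf E-\mathrm i\omega\mu_0\mathbf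 H=\mathbf J_1 & \text{a.e. in } \mathcal K_{r_0},\\ \nabla\wedge\mathbf H+\mathrm i\omega\varepsilon_0\mathbf E=\mathbf J_2 & \text{a.e. in } \mathcal K_{r_0},\\ \nu\times\mathbf E=\nu\times\mathbf H=\mathbf 0 & \text{on } \partial\mathcal K_{r_0}\setminus\partial B_{r_0}(\mathbf x_0),\end{cases}$$ where $\nu$ is the exterior unit normal. The boundary condition is understood in the sense of tangential traces: for $\mathbf u=\mathbf E$ and $\mathbf u=\mathbf H$, $$\int_{\mathcal K_{r_0}}\big((\nabla\wedge\mathbf u)\cdot\boldsymbol\varphi-\mathbf u\cdot(\nabla\wedge\boldsymbol\varphi)\big)\,\mathrm d\mathbf x=0$$ for every $\boldsymbol\varphi\in C_c^\infty(\mathbb R^3;\mathbb C^3)$ whose support does not meet $\partial\mathcal K_{r_0}\cap\partial B_{r_0}(\mathbf x_0)$, where $\cdot$ is the bilinear product $\mathbf z\cdot\mathbf w=\sum_i z_iw_i$. Then $$\mathbf J_1(\mathbf x_0)=\mathbf J_2(\mathbf x_0)=\mathbf 0.$$ -/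

import Mathlib

open MeasureTheory Set
open scoped NNReal

/-- Euclidean space `ℝ³`. -/
abbrev R3 := EuclideanSpace ℝ (Fin 3)

/-- The space `ℂ³` of field values, with its Hermitian norm. -/
abbrev C3 := EuclideanSpace ℂ (Fin 3)

/-- The open circular cone with apex `x₀`, axis `a` and half opening angle `θ₀`: the points `x` for
which the angle between `x - x₀` and `a` is less than `θ₀`. (Mathlib's angle between `0` and `a` is
`π / 2`, so the apex is not in the cone when `θ₀ < π / 2`.) -/
def circularCone (x₀ a : R3) (θ₀ : ℝ) : Set R3 :=
  {x | InnerProductGeometry.angle (x - x₀) a < θ₀}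

/-- The cone truncated by the open ball of radius `r₀` around its apex. -/
def truncatedCone (x₀ a : R3) (θ₀ r₀ : ℝ) : Set R3 :=
  circularCone x₀ a θ₀ ∩ Metric.ball x₀ r₀

/-- The bilinear (not conjugated) product `z · w = ∑ zᵢ wᵢ` on `ℂ³`. -/
def bdot (z w : C3) : ℂ := ∑ i, z i * w i

/-- The `i`-th partial derivative of the `j`-th component of a vector field on `ℝ³`. -/
noncomputable def partialDeriv (i j : Fin 3) (φ : R3 → C3) (x : R3) : ℂ :=
  fderiv ℝ φ x (EuclideanSpace.single i 1) j

/-- The classical curl of a differentiable vector field. -/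
noncomputable def curl (φ : R3 → C3) (x : R3) : C3 :=
  !₂[partialDeriv 1 2 φ x - partialDeriv 2 1 φ x,
     partialDeriv 2 0 φ x - partialDeriv 0 2 φ x,
     partialDeriv 0 1 φ x - partialDeriv 1 0 φ x]

/-- `c` is the curl of `u` in `Ω` in the sense of distributions, both being square integrable. -/
def IsWeakCurl (Ω : Set R3) (u c : R3 → C3) : Prop :=
  MemLp u 2 (volume.restrict Ω) ∧ MemLp c 2 (volume.restrict Ω) ∧
    ∀ φ : R3 → C3, ContDiff ℝ (⊤ : ℕ∞) φ → HasCompactSupport φ → tsupport φ ⊆ Ω →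
      ∫ x in Ω, bdot (u x) (curl φ x) = ∫ x in Ω, bdot (c x) (φ x)

/-- The space `H(curl, Ω)`: square integrable fields whose distributional curl is square
integrable. -/
def MemHCurl (Ω : Set R3) (u : R3 → C3) : Prop := ∃ c, IsWeakCurl Ω u c

open Classical in
/-- The distributional curl of `u ∈ H(curl, Ω)` (unique almost everywhere in an open `Ω`, see
`IsWeakCurl.ae_eq`); the zero field for `u ∉ H(curl, Ω)`. -/
noncomputable def weakCurl (Ω : Set R3) (u : R3 → C3) : R3 → C3 :=
  if h : MemHCurl Ω u then h.choose else 0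

/-- The tangential trace `ν × u` on `∂Ω` of `u ∈ H(curl, Ω)` (`ν` the exterior unit normal), as a
functional on smooth fields `φ`, given by Green's formula
`∫_{∂Ω} (ν × u) · φ dσ = ∫_Ω (curl u · φ - u · curl φ) dx`. -/
noncomputable def tangentialTrace (Ω : Set R3) (u φ : R3 → C3) : ℂ :=
  ∫ x in Ω, (bdot (weakCurl Ω u x) (φ x) - bdot (u x) (curl φ x))

/-- `ν × u = 0` on the relatively open part `Γ` of `∂Ω`: the tangential trace of `u` vanishes on all
smooth compactly supported fields on `ℝ³` whose support does not meet `∂Ω \ Γ`. -/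
def TangentialTraceVanishesOn (Ω Γ : Set R3) (u : R3 → C3) : Prop :=
  ∀ φ : R3 → C3, ContDiff ℝ (⊤ : ℕ∞) φ → HasCompactSupport φ →
    Disjoint (tsupport φ) (frontier Ω \ Γ) → tangentialTrace Ω u φ = 0

/-- The lateral boundary `∂K \ ∂B` of the truncated cone. -/
def lateralBoundary (x₀ a : R3) (θ₀ r₀ : ℝ) : Set R3 :=
  frontier (truncatedCone x₀ a θ₀ r₀) \ Metric.sphere x₀ r₀

/-- The weak curl is unique almost everywhere. -/
theorem IsWeakCurl.ae_eq {Ω : Set R3} (hΩ : IsOpen Ω) {u c c' : R3 → C3}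
    (h : IsWeakCurl Ω u c) (h' : IsWeakCurl Ω u c') :
    ∀ᵐ x ∂(volume.restrict Ω), c x = c' x := by
  have key : ∀ j : Fin 3, ∀ᵐ x ∂volume, x ∈ Ω → c x j - c' x j = 0 := by
    intro j
    have e1 : ∀ {f : R3 → C3}, MemLp f 2 (volume.restrict Ω) →
        MemLp (fun x => f x j) 2 (volume.restrict Ω) := fun hf =>
      (EuclideanSpace.proj (𝕜 := ℂ) j).comp_memLp' hf
    have hloc : ∀ {f : R3 → C3}, MemLp f 2 (volume.restrict Ω) →
        LocallyIntegrable (fun x => f x j) (volume.restrict Ω) := fun hf =>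
      (e1 hf).locallyIntegrable (by norm_num)
    refine hΩ.ae_eq_zero_of_integral_contDiff_smul_eq_zero (f := fun x => c x j - c' x j)
      (locallyIntegrableOn_of_locallyIntegrable_restrict ((hloc h.2.1).sub (hloc h'.2.1))) ?_
    intro g hg hgc hgs
    have hφ : ContDiff ℝ (⊤ : ℕ∞) (fun x => EuclideanSpace.single j (g x : ℂ) : R3 → C3) := by
      have hs : (fun x => EuclideanSpace.single j (g x : ℂ) : R3 → C3) =
          fun x => g x • (EuclideanSpace.single j (1 : ℂ) : C3) := by
        funext x; ext i
        by_cases hij : i = j <;> simp [hij]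
      rw [hs]
      exact hg.smul contDiff_const
    have hsup : tsupport (fun x => EuclideanSpace.single j (g x : ℂ) : R3 → C3) ⊆ tsupport g := by
      refine closure_mono fun x hx hgx => hx ?_
      simp [hgx]
    have hφc : HasCompactSupport (fun x => EuclideanSpace.single j (g x : ℂ) : R3 → C3) :=
      hgc.of_isClosed_subset (isClosed_tsupport _) hsup
    have a1 := h.2.2 _ hφ hφc (hsup.trans hgs)
    have a2 := h'.2.2 _ hφ hφc (hsup.trans hgs)
    have a3 := a1.symm.trans a2
    have hb : ∀ z : C3, ∀ t : ℂ, bdot z (EuclideanSpace.single j t) = t * z j := by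
      intro z t
      simp [bdot, mul_comm]
    simp only [hb] at a3
    have hi : ∀ {f : R3 → C3}, MemLp f 2 (volume.restrict Ω) →
        Integrable (fun x => (g x : ℂ) * f x j) (volume.restrict Ω) := by
      intro f hf
      have := (hloc hf).integrable_smul_left_of_hasCompactSupport hg.continuous hgc
      simpa using this
    have a4 : ∫ x in Ω, g x • (c x j - c' x j) = 0 := by
      have : ∀ x, g x • (c x j - c' x j) = (g x : ℂ) * c x j - (g x : ℂ) * c' x j := by
        intro x; simp [mul_sub]
      simp only [this]
      rw [integral_sub (hi h.2.1) (hi h'.2.1), a3, sub_self]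
    rw [← a4, setIntegral_eq_integral_of_forall_compl_eq_zero]
    intro x hx
    have : g x = 0 := by
      by_contra hne
      exact hx (hgs (subset_tsupport _ hne))
    simp [this]
  rw [ae_restrict_iff' hΩ.measurableSet]
  filter_upwards [key 0, key 1, key 2] with x h0 h1 h2 hx
  ext i
  fin_cases i
  · exact sub_eq_zero.1 (h0 hx)
  · exact sub_eq_zero.1 (h1 hx)
  · exact sub_eq_zero.1 (h2 hx)

/-!
For a null vector `ρ = -a + i b`, with `b` a unit vector orthogonal to `a`, the plane wave
`exp (s ρ · (x - x₀))` decays exponentially in the cone as `s → ∞`, uniformly away from the apex.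
Let `W f` be the integral over the cone of `f` against this wave, cut off near the apex. The
vanishing of the tangential trace gives `W (curl u) = s (W u) × ρ` up to an exponentially small
error, so a system `curl u = m v + J`, `curl v = n u + J'` becomes
`s (W u) × ρ ≈ m W v + W J` and `s (W v) × ρ ≈ n W u + W J'`.

By scaling, `s W v → 0` because `v ∈ L²`, and `s³ W J → I J(x₀)` with
`I = ∫ exp (ρ · y) dy` over the infinite cone. Since `z ↦ z × ρ` is nilpotent
(`(z × ρ) × ρ = (ρ · z) ρ` when `ρ · ρ = 0`), the two relations improve the decay of `W u` and
`W v` in turn and end with `I (J(x₀) · ρ) ρ = 0`. The integral `I` reduces to the Fourier transform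
of `exp (-m |q|)` in the plane, which does not vanish, hence `J(x₀) · ρ = 0`. Letting `b` vary, with
both signs, gives `J(x₀) = 0`.
-/

open Filter Topology Module

section LaplaceIntegral

variable {E F : Type*} [NormedAddCommGroup E] [NormedSpace ℝ E]
  [NormedAddCommGroup F] [NormedSpace ℂ F]

theorem norm_cexp_mul_phase (ℓ : E →L[ℝ] ℂ) (s : ℝ) (y : E) :
    ‖Complex.exp (s * ℓ y)‖ = Real.exp (s * (ℓ y).re) := by
  rw [Complex.norm_exp, Complex.re_ofReal_mul]

theorem tendsto_pow_smul_zero_of_tendsto_pow_smul {w : ℝ → F} {L : F} {m n : ℕ} (hmn : m < n)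
    (h : Tendsto (fun s : ℝ => (s : ℂ) ^ n • w s) atTop (𝓝 L)) :
    Tendsto (fun s : ℝ => (s : ℂ) ^ m • w s) atTop (𝓝 0) := by
  have hinv : Tendsto (fun s : ℝ => ((s ^ (n - m))⁻¹ : ℝ)) atTop (𝓝 0) :=
    (tendsto_pow_atTop (Nat.sub_ne_zero_of_lt hmn)).inv_tendsto_atTop
  have hprod := ((Complex.continuous_ofReal.tendsto 0).comp hinv).smul h
  rw [Complex.ofReal_zero, zero_smul] at hprod
  refine hprod.congr' ?_
  filter_upwards [eventually_gt_atTop 0] with s hs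
  have hs' : (s : ℂ) ≠ 0 := Complex.ofReal_ne_zero.2 hs.ne'
  rw [Function.comp_apply, Complex.ofReal_inv, Complex.ofReal_pow, smul_smul]
  congr 1
  rw [inv_mul_eq_iff_eq_mul₀ (pow_ne_zero _ hs'), ← pow_add, Nat.sub_add_cancel hmn.le]

variable [MeasurableSpace E] {μ : Measure E} {ℓ : E →L[ℝ] ℂ} {x₀ : E} {s : ℝ}

/-- The Laplace integral `∫ exp (s ℓ (x - x₀)) f(x) dμ(x)` of `f` along a complex linear phase `ℓ`
based at `x₀`. Integrals over a domain `Ω` are obtained with `μ.restrict Ω`. -/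
noncomputable def laplaceIntegral (μ : Measure E) (ℓ : E →L[ℝ] ℂ) (x₀ : E) (f : E → F) (s : ℝ) :
    F :=
  ∫ x, Complex.exp (s * ℓ (x - x₀)) • f x ∂μ

theorem laplaceIntegral_const_smul (k : ℂ) (f : E → F) :
    laplaceIntegral μ ℓ x₀ (k • f) s = k • laplaceIntegral μ ℓ x₀ f s := by
  simp only [laplaceIntegral, Pi.smul_apply, smul_comm _ k]
  exact integral_smul k _

theorem tendsto_pow_smul_laplaceIntegral_of_re_le_neg {f : E → F} (hf : Integrable f μ) {δ : ℝ}
    (hδ : 0 < δ) (hℓ : ∀ᵐ x ∂μ, f x ≠ 0 → (ℓ (x - x₀)).re ≤ -δ) (n : ℕ) :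
    Tendsto (fun s : ℝ => (s : ℂ) ^ n • laplaceIntegral μ ℓ x₀ f s) atTop (𝓝 0) := by
  have hlim : Tendsto (fun s : ℝ => s ^ (n : ℝ) * Real.exp (-δ * s) * ∫ x, ‖f x‖ ∂μ) atTop
      (𝓝 0) := by
    simpa using (tendsto_rpow_mul_exp_neg_mul_atTop_nhds_zero n δ hδ).mul_const (∫ x, ‖f x‖ ∂μ)
  refine squeeze_zero_norm' ?_ hlim
  filter_upwards [eventually_ge_atTop 0] with s hs
  have hbound : ‖laplaceIntegral μ ℓ x₀ f s‖ ≤ ∫ x, Real.exp (-δ * s) * ‖f x‖ ∂μ := by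
    refine norm_integral_le_of_norm_le (hf.norm.const_mul _) ?_
    filter_upwards [hℓ] with x hx
    rw [norm_smul, norm_cexp_mul_phase]
    rcases eq_or_ne (f x) 0 with h0 | h0
    · simp [h0]
    · refine mul_le_mul_of_nonneg_right (Real.exp_le_exp.2 ?_) (norm_nonneg _)
      linarith [mul_le_mul_of_nonneg_left (hx h0) hs]
  rw [norm_smul, norm_pow, Complex.norm_real, Real.norm_of_nonneg hs, Real.rpow_natCast, mul_assoc,
    ← integral_const_mul]
  gcongr

variable [BorelSpace E]

theorem integrable_cexp_smul {f : E → F} (hf : Integrable f μ)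
    (hℓ : ∀ᵐ x ∂μ, (ℓ (x - x₀)).re ≤ 0) (hs : 0 ≤ s) :
    Integrable (fun x => Complex.exp (s * ℓ (x - x₀)) • f x) μ := by
  refine hf.bdd_smul (φ := fun x => Complex.exp (s * ℓ (x - x₀))) 1
    (Continuous.aestronglyMeasurable (by fun_prop)) ?_
  filter_upwards [hℓ] with x hx
  rw [norm_cexp_mul_phase]
  exact Real.exp_le_one_iff.2 (mul_nonpos_of_nonneg_of_nonpos hs hx)

theorem laplaceIntegral_add {f g : E → F} (hf : Integrable f μ) (hg : Integrable g μ)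
    (hℓ : ∀ᵐ x ∂μ, (ℓ (x - x₀)).re ≤ 0) (hs : 0 ≤ s) :
    laplaceIntegral μ ℓ x₀ (f + g) s =
      laplaceIntegral μ ℓ x₀ f s + laplaceIntegral μ ℓ x₀ g s := by
  simp only [laplaceIntegral, Pi.add_apply, smul_add]
  exact integral_add (integrable_cexp_smul hf hℓ hs) (integrable_cexp_smul hg hℓ hs)

end LaplaceIntegral

section IsConicalAt

variable {E F : Type*} [NormedAddCommGroup E] [NormedSpace ℝ E]

/-- `Ω` lies in the translate `x₀ + K` of the cone `K` and coincides with it near `x₀`. -/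
structure IsConicalAt (Ω K : Set E) (x₀ : E) : Prop where
  smul_mem : ∀ t : ℝ, 0 < t → ∀ y ∈ K, t • y ∈ K
  sub_mem : ∀ x ∈ Ω, x - x₀ ∈ K
  eventually_mem : ∀ᶠ x in 𝓝 x₀, x - x₀ ∈ K → x ∈ Ω

theorem IsConicalAt.tendsto_indicator [Zero F] [TopologicalSpace F] {Ω K : Set E} {x₀ : E}
    (h : IsConicalAt Ω K x₀) {f : E → F} {L : F}
    (hL : Tendsto f (𝓝[Ω] x₀) (𝓝 L)) (y : E) :
    Tendsto (fun s : ℝ => Ω.indicator f (x₀ + s⁻¹ • y)) atTop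
      (𝓝 (K.indicator (fun _ => L) y)) := by
  have hx₀ : Tendsto (fun s : ℝ => x₀ + s⁻¹ • y) atTop (𝓝 x₀) := by
    simpa using ((tendsto_inv_atTop_zero (𝕜 := ℝ)).smul_const y).const_add x₀
  by_cases hy : y ∈ K
  · have hmem : ∀ᶠ s : ℝ in atTop, x₀ + s⁻¹ • y ∈ Ω := by
      filter_upwards [hx₀.eventually h.eventually_mem, eventually_gt_atTop 0] with s hs hs0
      exact hs (by simpa using h.smul_mem _ (inv_pos.2 hs0) y hy)
    rw [indicator_of_mem hy]
    refine (hL.comp (tendsto_nhdsWithin_iff.2 ⟨hx₀, hmem⟩)).congr' ?_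
    filter_upwards [hmem] with s hs
    rw [indicator_of_mem hs, Function.comp_apply]
  · rw [indicator_of_notMem hy]
    refine tendsto_const_nhds.congr' ?_
    filter_upwards [eventually_gt_atTop 0] with s hs
    refine (indicator_of_notMem (fun hmem => hy ?_) f).symm
    simpa [hs.ne'] using h.smul_mem s hs _ (h.sub_mem _ hmem)

end IsConicalAt

section Scaling

variable {E F : Type*} [NormedAddCommGroup E] [NormedSpace ℝ E] [FiniteDimensional ℝ E]
  [MeasurableSpace E] [BorelSpace E] {μ : Measure E} [μ.IsAddHaarMeasure]
  [NormedAddCommGroup F] {ℓ : E →L[ℝ] ℂ} {x₀ : E} {c : ℝ}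

theorem integral_comp_smul_sub [NormedSpace ℝ F] (g : E → F) (x₀ : E) {s : ℝ} (hs : 0 ≤ s) :
    ∫ x, g (s • (x - x₀)) ∂μ = (s ^ finrank ℝ E)⁻¹ • ∫ y, g y ∂μ := by
  rw [integral_sub_right_eq_self (fun x => g (s • x)) x₀, Measure.integral_comp_smul,
    abs_of_nonneg (by positivity)]

theorem integrable_exp_neg_mul_norm [Nontrivial E] (μ : Measure E) [μ.IsAddHaarMeasure]
    (hc : 0 < c) : Integrable (fun x : E => Real.exp (-(c * ‖x‖))) μ := by
  refine (integrable_fun_norm_addHaar μ (f := fun t : ℝ => Real.exp (-(c * t)))).2 ?_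
  have h := integrableOn_rpow_mul_exp_neg_mul_rpow (p := 1) (s := (finrank ℝ E - 1 : ℕ)) (b := c)
    (by linarith [Nat.cast_nonneg (α := ℝ) (finrank ℝ E - 1)]) one_pos hc
  simpa only [Real.rpow_natCast, Real.rpow_one, neg_mul, smul_eq_mul] using h

variable [NormedSpace ℂ F]

theorem norm_laplaceIntegral_le_of_memLp_two [Nontrivial E] {Ω : Set E}
    (hΩ : MeasurableSet Ω) {f : E → F} (hf : MemLp f 2 (μ.restrict Ω)) (hc : 0 < c)
    (hℓ : ∀ x ∈ Ω, (ℓ (x - x₀)).re ≤ -(c * ‖x - x₀‖)) {s : ℝ} (hs : 0 < s) :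
    ‖laplaceIntegral (μ.restrict Ω) ℓ x₀ f s‖ ≤
      √((s ^ finrank ℝ E)⁻¹ * ∫ y, Real.exp (-(2 * c * ‖y‖)) ∂μ) *
        √(∫ x in Ω, ‖f x‖ ^ 2 ∂μ) := by
  set h : E → ℝ := fun x => Real.exp (-(c * ‖s • (x - x₀)‖))
  have hsq (x : E) : h x ^ 2 = Real.exp (-(2 * c * ‖s • (x - x₀)‖)) := by
    rw [← Real.exp_nat_mul]; congr 1; push_cast; ring
  have hsq_int : Integrable (fun x => h x ^ 2) μ := by
    simp only [hsq]
    exact ((integrable_comp_smul_iff μ _ hs.ne').2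
      (integrable_exp_neg_mul_norm μ (by positivity : 0 < 2 * c))).comp_sub_right x₀
  have hh : MemLp h 2 (μ.restrict Ω) :=
    ((memLp_two_iff_integrable_sq (Continuous.aestronglyMeasurable (by fun_prop))).2
      hsq_int).restrict Ω
  have hHolder := integral_mul_norm_le_Lp_mul_Lq Real.HolderConjugate.two_two
    (by simpa using hh) (by simpa using hf.norm)
  have hHolder' : ∫ x in Ω, h x * ‖f x‖ ∂μ ≤
      √(∫ x in Ω, h x ^ 2 ∂μ) * √(∫ x in Ω, ‖f x‖ ^ 2 ∂μ) := by
    simpa only [Real.rpow_ofNat, ← Real.sqrt_eq_rpow, Real.norm_eq_abs, sq_abs, abs_norm,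
      abs_of_pos (Real.exp_pos _), h] using hHolder
  have hle : ∀ᵐ x ∂μ.restrict Ω, ‖Complex.exp (s * ℓ (x - x₀)) • f x‖ ≤ h x * ‖f x‖ := by
    filter_upwards [ae_restrict_mem hΩ] with x hx
    rw [norm_smul, norm_cexp_mul_phase]
    refine mul_le_mul_of_nonneg_right (Real.exp_le_exp.2 ?_) (norm_nonneg _)
    rw [norm_smul, Real.norm_of_nonneg hs.le]
    linarith [mul_le_mul_of_nonneg_left (hℓ x hx) hs.le]
  calc ‖laplaceIntegral (μ.restrict Ω) ℓ x₀ f s‖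
      ≤ ∫ x in Ω, h x * ‖f x‖ ∂μ := norm_integral_le_of_norm_le (hh.integrable_mul hf.norm) hle
    _ ≤ √(∫ x in Ω, h x ^ 2 ∂μ) * √(∫ x in Ω, ‖f x‖ ^ 2 ∂μ) := hHolder'
    _ ≤ √(∫ x, h x ^ 2 ∂μ) * √(∫ x in Ω, ‖f x‖ ^ 2 ∂μ) := by
        gcongr
        · exact Eventually.of_forall fun x => sq_nonneg (h x)
        · exact Measure.restrict_le_self
    _ = _ := by
        simp only [hsq]
        rw [integral_comp_smul_sub (fun y => Real.exp (-(2 * c * ‖y‖))) x₀ hs.le, smul_eq_mul]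

theorem tendsto_pow_smul_laplaceIntegral_of_memLp_two [Nontrivial E] {Ω : Set E}
    (hΩ : MeasurableSet Ω) {f : E → F} (hf : MemLp f 2 (μ.restrict Ω)) (hc : 0 < c)
    (hℓ : ∀ x ∈ Ω, (ℓ (x - x₀)).re ≤ -(c * ‖x - x₀‖)) {n : ℕ} (hn : 2 * n < finrank ℝ E) :
    Tendsto (fun s : ℝ => (s : ℂ) ^ n • laplaceIntegral (μ.restrict Ω) ℓ x₀ f s) atTop (𝓝 0) := by
  set A := ∫ y, Real.exp (-(2 * c * ‖y‖)) ∂μ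
  set B := √(∫ x in Ω, ‖f x‖ ^ 2 ∂μ)
  have hlim : Tendsto (fun s : ℝ => √((s ^ (finrank ℝ E - 2 * n))⁻¹ * A) * B) atTop (𝓝 0) := by
    have hinv : Tendsto (fun s : ℝ => (s ^ (finrank ℝ E - 2 * n))⁻¹) atTop (𝓝 0) :=
      (tendsto_pow_atTop (Nat.sub_ne_zero_of_lt hn)).inv_tendsto_atTop
    simpa using ((hinv.mul_const A).sqrt).mul_const B
  refine squeeze_zero_norm' ?_ hlim
  filter_upwards [eventually_gt_atTop 0] with s hs
  have hpow : s ^ (2 * n) * (s ^ finrank ℝ E)⁻¹ = (s ^ (finrank ℝ E - 2 * n))⁻¹ := by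
    rw [← Nat.sub_add_cancel hn.le, pow_add, Nat.add_sub_cancel]
    field_simp
  calc ‖(s : ℂ) ^ n • laplaceIntegral (μ.restrict Ω) ℓ x₀ f s‖
      ≤ s ^ n * (√((s ^ finrank ℝ E)⁻¹ * A) * B) := by
        rw [norm_smul, norm_pow, Complex.norm_real, Real.norm_of_nonneg hs.le]
        gcongr
        exact norm_laplaceIntegral_le_of_memLp_two hΩ hf hc hℓ hs
    _ = √((s ^ (finrank ℝ E - 2 * n))⁻¹ * A) * B := by
        rw [← hpow, mul_assoc (s ^ (2 * n)), Real.sqrt_mul (by positivity) (_ * A), mul_comm 2 n,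
          pow_mul, Real.sqrt_sq (by positivity), mul_assoc]

theorem pow_smul_laplaceIntegral_eq_integral_indicator {Ω : Set E} (hΩ : MeasurableSet Ω)
    (f : E → F) {s : ℝ} (hs : 0 < s) :
    (s : ℂ) ^ finrank ℝ E • laplaceIntegral (μ.restrict Ω) ℓ x₀ f s =
      ∫ y, Complex.exp (ℓ y) • Ω.indicator f (x₀ + s⁻¹ • y) ∂μ := by
  have hscale (x : E) : Ω.indicator (fun x => Complex.exp (s * ℓ (x - x₀)) • f x) x =
      Complex.exp (ℓ (s • (x - x₀))) • Ω.indicator f (x₀ + s⁻¹ • s • (x - x₀)) := by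
    simp only [inv_smul_smul₀ hs.ne', add_sub_cancel, indicator_smul_apply, map_smul,
      Complex.real_smul]
  have hs' : (s : ℂ) ^ finrank ℝ E ≠ 0 := pow_ne_zero _ (Complex.ofReal_ne_zero.2 hs.ne')
  rw [laplaceIntegral, ← integral_indicator hΩ, integral_congr_ae (ae_of_all _ hscale),
    integral_comp_smul_sub (fun y => Complex.exp (ℓ y) • Ω.indicator f (x₀ + s⁻¹ • y)) x₀ hs.le,
    ← Complex.coe_smul, Complex.ofReal_inv, Complex.ofReal_pow, smul_inv_smul₀ hs']

theorem tendsto_pow_smul_laplaceIntegral_of_bounded [Nontrivial E] {Ω K : Set E}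
    (hΩ : MeasurableSet Ω) (hK : MeasurableSet K) (hΩK : IsConicalAt Ω K x₀) (hc : 0 < c)
    (hℓ : ∀ y ∈ K, (ℓ y).re ≤ -(c * ‖y‖)) {f : E → F} {L : F} {M : ℝ}
    (hf : IntegrableOn f Ω μ) (hM : ∀ x ∈ Ω, ‖f x‖ ≤ M) (hL : Tendsto f (𝓝[Ω] x₀) (𝓝 L)) :
    Tendsto (fun s : ℝ => (s : ℂ) ^ finrank ℝ E • laplaceIntegral (μ.restrict Ω) ℓ x₀ f s) atTop
      (𝓝 (∫ y in K, Complex.exp (ℓ y) • L ∂μ)) := by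
  have hlim : Tendsto (fun s : ℝ => ∫ y, Complex.exp (ℓ y) • Ω.indicator f (x₀ + s⁻¹ • y) ∂μ)
      atTop (𝓝 (∫ y, Complex.exp (ℓ y) • K.indicator (fun _ => L) y ∂μ)) := by
    refine tendsto_integral_filter_of_dominated_convergence
      (fun y => Real.exp (-(c * ‖y‖)) * |M|) ?_ ?_
      ((integrable_exp_neg_mul_norm μ hc).mul_const |M|)
      (ae_of_all _ fun y => (hΩK.tendsto_indicator hL y).const_smul _)
    · filter_upwards [eventually_gt_atTop 0] with s hs
      have hcomp : Integrable (fun y => Ω.indicator f (x₀ + s⁻¹ • y)) μ :=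
        (integrable_comp_smul_iff μ _ (inv_pos.2 hs).ne').2
          ((hf.integrable_indicator hΩ).comp_add_left x₀)
      exact AEStronglyMeasurable.smul (Continuous.aestronglyMeasurable (by fun_prop))
        hcomp.aestronglyMeasurable
    · filter_upwards [eventually_gt_atTop 0] with s hs
      refine ae_of_all _ fun y => ?_
      by_cases hy : x₀ + s⁻¹ • y ∈ Ω
      · have hyK : y ∈ K := by simpa [hs.ne'] using hΩK.smul_mem s hs _ (hΩK.sub_mem _ hy)
        rw [indicator_of_mem hy, norm_smul, Complex.norm_exp]
        exact mul_le_mul (Real.exp_le_exp.2 (hℓ y hyK)) ((hM _ hy).trans (le_abs_self M))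
          (norm_nonneg _) (Real.exp_pos _).le
      · rw [indicator_of_notMem hy, smul_zero, norm_zero]
        positivity
  have hind (y : E) : Complex.exp (ℓ y) • K.indicator (fun _ => L) y =
      K.indicator (fun y => Complex.exp (ℓ y) • L) y :=
    (indicator_smul_apply K (fun y => Complex.exp (ℓ y)) (fun _ => L) y).symm
  simp only [hind, integral_indicator hK] at hlim
  refine hlim.congr' ?_
  filter_upwards [eventually_gt_atTop 0] with s hs
  exact (pow_smul_laplaceIntegral_eq_integral_indicator hΩ f hs).symm

theorem tendsto_pow_smul_laplaceIntegral [Nontrivial E] {Ω K : Set E}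
    (hΩ : MeasurableSet Ω) (hK : MeasurableSet K) (hΩK : IsConicalAt Ω K x₀) (hc : 0 < c)
    (hℓ : ∀ y ∈ K, (ℓ y).re ≤ -(c * ‖y‖)) {f : E → F} {L : F}
    (hf : IntegrableOn f Ω μ) (hL : Tendsto f (𝓝[Ω] x₀) (𝓝 L)) :
    Tendsto (fun s : ℝ => (s : ℂ) ^ finrank ℝ E • laplaceIntegral (μ.restrict Ω) ℓ x₀ f s) atTop
      (𝓝 (∫ y in K, Complex.exp (ℓ y) • L ∂μ)) := by
  obtain ⟨r, hr, hball⟩ : ∃ r > 0, ∀ x ∈ Ω, x ∈ Metric.ball x₀ r → ‖f x‖ ≤ ‖L‖ + 1 := by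
    have hev := hL.norm.eventually_le_const (lt_add_one ‖L‖)
    rw [eventually_nhdsWithin_iff, Metric.eventually_nhds_iff_ball] at hev
    exact hev.imp fun r h => ⟨h.1, fun x hx hxr => h.2 x hxr hx⟩
  have hdecomp : f = (Metric.ball x₀ r).indicator f + (Metric.ball x₀ r)ᶜ.indicator f :=
    (indicator_self_add_compl _ f).symm
  have hnear : Tendsto (fun s : ℝ => (s : ℂ) ^ finrank ℝ E •
      laplaceIntegral (μ.restrict Ω) ℓ x₀ ((Metric.ball x₀ r).indicator f) s) atTop
      (𝓝 (∫ y in K, Complex.exp (ℓ y) • L ∂μ)) := by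
    refine tendsto_pow_smul_laplaceIntegral_of_bounded hΩ hK hΩK hc hℓ (M := ‖L‖ + 1)
      (hf.indicator measurableSet_ball) (fun x hx => ?_) (hL.congr' ?_)
    · by_cases hxr : x ∈ Metric.ball x₀ r
      · rw [indicator_of_mem hxr]
        exact hball x hx hxr
      · rw [indicator_of_notMem hxr, norm_zero]
        positivity
    · filter_upwards [nhdsWithin_le_nhds (Metric.ball_mem_nhds x₀ hr)] with x hx
      rw [indicator_of_mem hx]
  have hfar := tendsto_pow_smul_laplaceIntegral_of_re_le_neg (μ := μ.restrict Ω) (ℓ := ℓ)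
    (x₀ := x₀) (hf.indicator measurableSet_ball.compl) (mul_pos hc hr) (by
      filter_upwards [ae_restrict_mem hΩ] with x hx hne
      have hxr : r ≤ ‖x - x₀‖ := by
        simpa [dist_eq_norm] using mem_of_indicator_ne_zero hne
      linarith [hℓ _ (hΩK.sub_mem x hx), mul_le_mul_of_nonneg_left hxr hc.le]) (finrank ℝ E)
  have hsum := hnear.add hfar
  rw [add_zero] at hsum
  refine hsum.congr' ?_
  filter_upwards [eventually_ge_atTop 0] with s hs
  have hre : ∀ᵐ x ∂μ.restrict Ω, (ℓ (x - x₀)).re ≤ 0 := by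
    filter_upwards [ae_restrict_mem hΩ] with x hx
    exact (hℓ _ (hΩK.sub_mem x hx)).trans (neg_nonpos.2 (by positivity))
  rw [← smul_add, ← laplaceIntegral_add (hf.indicator measurableSet_ball)
    (hf.indicator measurableSet_ball.compl) hre hs, ← hdecomp]

end Scaling

section VectorCalculus

theorem bdot_eq_dotProduct (z w : C3) : bdot z w = z.ofLp ⬝ᵥ w.ofLp := rfl

/-- The bilinear (not conjugated) cross product on `ℂ³`, as a continuous bilinear map. -/
noncomputable def ccross : C3 →L[ℂ] C3 →L[ℂ] C3 :=
  LinearMap.toContinuousBilinearMap <|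
    (crossProduct.compl₁₂ (WithLp.linearEquiv 2 ℂ (Fin 3 → ℂ)).toLinearMap
      (WithLp.linearEquiv 2 ℂ (Fin 3 → ℂ)).toLinearMap).compr₂
      (WithLp.linearEquiv 2 ℂ (Fin 3 → ℂ)).symm.toLinearMap

open scoped Matrix in
theorem ccross_apply (z w : C3) : ccross z w = WithLp.toLp 2 (z.ofLp ⨯₃ w.ofLp) := rfl

theorem bdot_ccross_right (u v w : C3) : bdot u (ccross v w) = bdot (ccross u v) w := by
  simp only [bdot_eq_dotProduct, ccross_apply, dotProduct_comm _ w.ofLp]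
  rw [triple_product_permutation, triple_product_permutation]

theorem bdot_ccross_self (z w : C3) : bdot (ccross z w) w = 0 := by
  rw [bdot_eq_dotProduct, dotProduct_comm, ccross_apply, dot_cross_self]

theorem ccross_ccross_self {ρ : C3} (hρ : bdot ρ ρ = 0) (z : C3) :
    ccross (ccross z ρ) ρ = bdot z ρ • ρ := by
  rw [bdot_eq_dotProduct] at hρ
  simp only [ccross_apply, cross_cross_eq_smul_sub_smul, hρ, zero_smul, sub_zero]
  rfl

/-- The gradient of a complex function on `ℝ³`, as a vector of `ℂ³`. -/
noncomputable def cgrad (g : R3 → ℂ) (x : R3) : C3 :=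
  WithLp.toLp 2 fun i => fderiv ℝ g x (EuclideanSpace.single i 1)

theorem cgrad_mul {g h : R3 → ℂ} {x : R3} (hg : DifferentiableAt ℝ g x)
    (hh : DifferentiableAt ℝ h x) :
    cgrad (fun y => g y * h y) x = g x • cgrad h x + h x • cgrad g x := by
  ext i
  simp [cgrad, fderiv_fun_mul hg hh]

theorem continuous_cgrad {g : R3 → ℂ} {n : WithTop ℕ∞} (hg : ContDiff ℝ n g) (hn : n ≠ 0) :
    Continuous (cgrad g) :=
  (PiLp.continuous_toLp 2 _).comp <| continuous_pi fun _ =>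
    (hg.continuous_fderiv hn).clm_apply continuous_const

theorem hasCompactSupport_cgrad {g : R3 → ℂ} (hg : HasCompactSupport g) :
    HasCompactSupport (cgrad g) :=
  (hg.fderiv ℝ).mono fun x hx h => hx <| by
    ext i
    simp [cgrad, h]

theorem curl_smul_const {g : R3 → ℂ} {x : R3} (hg : DifferentiableAt ℝ g x) (p : C3) :
    curl (fun y => g y • p) x = ccross (cgrad g x) p := by
  ext i
  fin_cases i <;>
    simp [curl, partialDeriv, ccross_apply, cross_apply, cgrad, fderiv_smul_const hg]

/-- The complex linear phase `x ↦ ρ · x` with wave vector `ρ ∈ ℂ³`. -/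
noncomputable def linearPhase (ρ : C3) : R3 →L[ℝ] ℂ :=
  ∑ i, (EuclideanSpace.proj i : R3 →L[ℝ] ℝ).smulRight (ρ i)

theorem linearPhase_single (ρ : C3) (i : Fin 3) :
    linearPhase ρ (EuclideanSpace.single i 1) = ρ i := by
  simp [linearPhase]

theorem cgrad_cexp_linearPhase (ρ : C3) (x₀ : R3) (s : ℝ) (x : R3) :
    cgrad (fun y => Complex.exp (s * linearPhase ρ (y - x₀))) x =
      (s : ℂ) • Complex.exp (s * linearPhase ρ (x - x₀)) • ρ := by
  have hd : HasFDerivAt (fun y => Complex.exp (s * linearPhase ρ (y - x₀)))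
      (Complex.exp (s * linearPhase ρ (x - x₀)) • (s : ℂ) • linearPhase ρ) x :=
    (((linearPhase ρ).hasFDerivAt.comp x ((hasFDerivAt_id x).sub_const x₀)).const_mul _).cexp
  ext i
  simp only [cgrad, hd.fderiv]
  simp [linearPhase_single, mul_left_comm]

end VectorCalculus

section Green

variable {Ω Γ : Set R3} {u : R3 → C3} {χ : R3 → ℂ}

theorem MemHCurl.isWeakCurl_weakCurl (hu : MemHCurl Ω u) : IsWeakCurl Ω u (weakCurl Ω u) := by
  rw [weakCurl, dif_pos hu]
  exact hu.choose_spec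

theorem memLp_smul_of_hasCompactSupport (hu : MemLp u 2 (volume.restrict Ω))
    (hχ : Continuous χ) (hχc : HasCompactSupport χ) : MemLp (χ • u) 2 (volume.restrict Ω) :=
  hu.smul (p := ⊤) (hχ.memLp_of_hasCompactSupport hχc)

theorem integrable_smul_of_hasCompactSupport (hu : MemLp u 2 (volume.restrict Ω))
    (hχ : Continuous χ) (hχc : HasCompactSupport χ) :
    Integrable (χ • u) (volume.restrict Ω) :=
  memLp_one_iff_integrable.1 (hu.smul (p := 2) (hχ.memLp_of_hasCompactSupport hχc))

theorem integrable_ccross_of_hasCompactSupport (hu : MemLp u 2 (volume.restrict Ω)) {v : R3 → C3}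
    (hv : Continuous v) (hvc : HasCompactSupport v) :
    Integrable (fun x => ccross (u x) (v x)) (volume.restrict Ω) :=
  memLp_one_iff_integrable.1 <|
    ccross.memLp_of_bilin (q := 2) 1 hu (hv.memLp_of_hasCompactSupport hvc)

theorem setIntegral_smul_weakCurl (hu : MemHCurl Ω u) (hΓ : TangentialTraceVanishesOn Ω Γ u)
    (hχ : ContDiff ℝ (⊤ : ℕ∞) χ) (hχc : HasCompactSupport χ)
    (hχΓ : Disjoint (tsupport χ) (frontier Ω \ Γ)) :
    ∫ x in Ω, χ x • weakCurl Ω u x = ∫ x in Ω, ccross (u x) (cgrad χ x) := by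
  have hcurl : Integrable (fun x => χ x • weakCurl Ω u x) (volume.restrict Ω) :=
    integrable_smul_of_hasCompactSupport hu.isWeakCurl_weakCurl.2.1 hχ.continuous hχc
  have hgrad := integrable_ccross_of_hasCompactSupport hu.isWeakCurl_weakCurl.1
    (continuous_cgrad hχ (by simp)) (hasCompactSupport_cgrad hχc)
  ext j
  have hsupp : tsupport (fun x => χ x • EuclideanSpace.single j (1 : ℂ)) ⊆ tsupport χ :=
    tsupport_smul_subset_left χ _
  have htrace := hΓ (fun x => χ x • EuclideanSpace.single j (1 : ℂ)) (hχ.smul contDiff_const)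
    hχc.smul_right (hχΓ.mono_left hsupp)
  have hcoord (z : C3) : bdot z (EuclideanSpace.single j 1) = z j := by
    simp [bdot]
  have hpair (x : R3) : bdot (weakCurl Ω u x) (χ x • EuclideanSpace.single j 1) -
      bdot (u x) (curl (fun x => χ x • EuclideanSpace.single j 1) x) =
        (χ x • weakCurl Ω u x - ccross (u x) (cgrad χ x)) j := by
    rw [curl_smul_const (hχ.differentiable (by simp) x), bdot_ccross_right, hcoord]
    simp [bdot, mul_comm]
  simp only [tangentialTrace, hpair] at htrace
  rw [← eval_integral_piLp fun i => (EuclideanSpace.proj (𝕜 := ℂ) i).integrable_comp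
    (hcurl.sub hgrad)] at htrace
  rw [← sub_eq_zero, ← PiLp.sub_apply, ← integral_sub hcurl hgrad]
  exact htrace

theorem laplaceIntegral_smul_weakCurl (hu : MemHCurl Ω u) (hΓ : TangentialTraceVanishesOn Ω Γ u)
    (hχ : ContDiff ℝ (⊤ : ℕ∞) χ) (hχc : HasCompactSupport χ)
    (hχΓ : Disjoint (tsupport χ) (frontier Ω \ Γ)) (ρ : C3) (x₀ : R3) (s : ℝ) :
    laplaceIntegral (volume.restrict Ω) (linearPhase ρ) x₀ (χ • weakCurl Ω u) s =
      (s : ℂ) • ccross (laplaceIntegral (volume.restrict Ω) (linearPhase ρ) x₀ (χ • u) s) ρ +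
        laplaceIntegral (volume.restrict Ω) (linearPhase ρ) x₀
          (fun x => ccross (u x) (cgrad χ x)) s := by
  have hu2 := hu.isWeakCurl_weakCurl.1
  set e : R3 → ℂ := fun x => Complex.exp (s * linearPhase ρ (x - x₀)) with he_def
  have he : ContDiff ℝ (⊤ : ℕ∞) e := by fun_prop
  have hχ1 : Differentiable ℝ χ := hχ.differentiable (by simp)
  have hmain : Integrable (fun x => e x • (χ • u) x) (volume.restrict Ω) := by
    simp only [Pi.smul_apply', smul_smul]
    exact integrable_smul_of_hasCompactSupport hu2 (he.continuous.mul hχ.continuous) hχc.mul_left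
  have hcommutator :
      Integrable (fun x => e x • ccross (u x) (cgrad χ x)) (volume.restrict Ω) := by
    simp only [← map_smul]
    exact integrable_ccross_of_hasCompactSupport (v := e • cgrad χ) hu2
      (he.continuous.smul (continuous_cgrad hχ (by simp))) (hasCompactSupport_cgrad hχc).smul_left
  have hgreen := setIntegral_smul_weakCurl (χ := fun x => e x * χ x) hu hΓ (he.mul hχ)
    hχc.mul_left (hχΓ.mono_left tsupport_mul_subset_right)
  have hgrad (x : R3) : ccross (u x) (cgrad (fun y => e y * χ y) x) =
      (s : ℂ) • ccross (e x • (χ • u) x) ρ + e x • ccross (u x) (cgrad χ x) := by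
    rw [cgrad_mul (he.differentiable (by simp) x) (hχ1 x), cgrad_cexp_linearPhase]
    simp only [map_add, map_smul, Pi.smul_apply', _root_.smul_apply, smul_smul]
    rw [add_comm]
    congr 2
    ring
  calc laplaceIntegral (volume.restrict Ω) (linearPhase ρ) x₀ (χ • weakCurl Ω u) s
      = ∫ x in Ω, (e x * χ x) • weakCurl Ω u x := by
        simp only [laplaceIntegral, Pi.smul_apply', smul_smul, he_def]
    _ = ∫ x in Ω, ((s : ℂ) • ccross (e x • (χ • u) x) ρ + e x • ccross (u x) (cgrad χ x)) := by
        rw [hgreen]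
        exact integral_congr_ae (ae_of_all _ hgrad)
    _ = (∫ x in Ω, (s : ℂ) • ccross.flip ρ (e x • (χ • u) x)) +
          ∫ x in Ω, e x • ccross (u x) (cgrad χ x) :=
        integral_add (((ccross.flip ρ).integrable_comp hmain).smul (s : ℂ)) hcommutator
    _ = (s : ℂ) • ccross.flip ρ (∫ x in Ω, e x • (χ • u) x) +
          ∫ x in Ω, e x • ccross (u x) (cgrad χ x) := by
        rw [integral_smul, (ccross.flip ρ).integral_comp_comm hmain]

end Green

theorem exists_contDiff_tsupport_subset_eventuallyEq_one {E : Type*} [NormedAddCommGroup E]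
    [NormedSpace ℝ E] [HasContDiffBump E] [FiniteDimensional ℝ E] {U : Set E} {x₀ : E}
    (hU : U ∈ 𝓝 x₀) :
    ∃ χ : E → ℂ, ContDiff ℝ (⊤ : ℕ∞) χ ∧ HasCompactSupport χ ∧ tsupport χ ⊆ U ∧
      χ =ᶠ[𝓝 x₀] 1 := by
  obtain ⟨r, hr, hrU⟩ := Metric.nhds_basis_closedBall.mem_iff.1 hU
  let f : ContDiffBump x₀ := ⟨r / 2, r, half_pos hr, half_lt_self hr⟩
  have hsupp : tsupport (fun x => (f x : ℂ)) ⊆ tsupport f :=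
    closure_mono fun x hx hfx => hx (by simp only [hfx, Complex.ofReal_zero])
  refine ⟨fun x => f x, Complex.ofRealCLM.contDiff.comp f.contDiff,
    f.hasCompactSupport.of_isClosed_subset (isClosed_tsupport _) hsupp,
    hsupp.trans (f.tsupport_eq.trans_subset hrU), ?_⟩
  filter_upwards [f.eventuallyEq_one] with x hx
  simp only [hx, Pi.one_apply, Complex.ofReal_one]

theorem apply_apply_eq_zero_of_tendsto {F : Type*} [NormedAddCommGroup F] [NormedSpace ℂ F]
    {P : F →L[ℂ] F} (hP : ∀ z, P (P (P z)) = 0) {m n : ℂ} {U V A A' B B' : ℝ → F} {L L' : F}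
    (h₁ : ∀ᶠ s : ℝ in atTop, (s : ℂ) • P (U s) + B s = m • V s + A s)
    (h₂ : ∀ᶠ s : ℝ in atTop, (s : ℂ) • P (V s) + B' s = n • U s + A' s)
    (hV : Tendsto (fun s : ℝ => (s : ℂ) ^ 1 • V s) atTop (𝓝 0))
    (hA : Tendsto (fun s : ℝ => (s : ℂ) ^ 3 • A s) atTop (𝓝 L))
    (hA' : Tendsto (fun s : ℝ => (s : ℂ) ^ 3 • A' s) atTop (𝓝 L'))
    (hB : Tendsto (fun s : ℝ => (s : ℂ) ^ 3 • B s) atTop (𝓝 0))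
    (hB' : Tendsto (fun s : ℝ => (s : ℂ) ^ 3 • B' s) atTop (𝓝 0)) :
    P (P L) = 0 := by
  have hPU : Tendsto (fun s : ℝ => (s : ℂ) ^ 2 • P (U s)) atTop (𝓝 0) := by
    have hlim := ((hV.const_smul m).add
      (tendsto_pow_smul_zero_of_tendsto_pow_smul (by decide : 1 < 3) hA)).sub
      (tendsto_pow_smul_zero_of_tendsto_pow_smul (by decide : 1 < 3) hB)
    simp only [smul_zero, add_zero, sub_zero] at hlim
    refine hlim.congr' ?_
    filter_upwards [h₁] with s hs
    rw [sq, mul_smul, eq_sub_of_add_eq hs]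
    module
  have hPPV : Tendsto (fun s : ℝ => (s : ℂ) ^ 3 • P (P (V s))) atTop (𝓝 0) := by
    have hlim := ((hPU.const_smul n).add ((P.continuous.tendsto 0).comp
      (tendsto_pow_smul_zero_of_tendsto_pow_smul (by decide : 2 < 3) hA'))).sub
      ((P.continuous.tendsto 0).comp
        (tendsto_pow_smul_zero_of_tendsto_pow_smul (by decide : 2 < 3) hB'))
    simp only [smul_zero, map_zero, add_zero, sub_zero] at hlim
    refine hlim.congr' ?_
    filter_upwards [h₂] with s hs
    rw [pow_succ (s : ℂ) 2, mul_smul, ← map_smul P _ (P _), eq_sub_of_add_eq hs]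
    simp only [Function.comp_apply, map_sub, map_add, map_smul]
    module
  have hPPA : Tendsto (fun s : ℝ => (s : ℂ) ^ 3 • P (P (A s))) atTop (𝓝 0) := by
    have hlim := (((P ∘L P).continuous.tendsto 0).comp hB).sub (hPPV.const_smul m)
    simp only [smul_zero, map_zero, sub_zero] at hlim
    refine hlim.congr' ?_
    filter_upwards [h₁] with s hs
    have hPP := congrArg (fun z => P (P z)) hs
    simp only [map_add, map_smul, hP, smul_zero, zero_add] at hPP
    simp only [Function.comp_apply, ContinuousLinearMap.comp_apply, map_smul, hPP]
    module
  refine tendsto_nhds_unique (((P ∘L P).continuous.tendsto L).comp hA) (hPPA.congr fun s => ?_)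
  simp only [Function.comp_apply, ContinuousLinearMap.comp_apply, map_smul]

section CurlSystem

variable {Ω Γ K : Set R3} {x₀ : R3} {ρ : C3} {c : ℝ} {u v J J' : R3 → C3} {χ : R3 → ℂ} {m n : ℂ}

theorem tendsto_pow_smul_laplaceIntegral_ccross_cgrad (hΩ : MeasurableSet Ω)
    (hu : MemLp u 2 (volume.restrict Ω)) (hχ : ContDiff ℝ (⊤ : ℕ∞) χ) (hχc : HasCompactSupport χ)
    (hχ1 : χ =ᶠ[𝓝 x₀] 1) (hc : 0 < c)
    (hℓ : ∀ x ∈ Ω, (linearPhase ρ (x - x₀)).re ≤ -(c * ‖x - x₀‖)) (n : ℕ) :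
    Tendsto (fun s : ℝ => (s : ℂ) ^ n • laplaceIntegral (volume.restrict Ω) (linearPhase ρ) x₀
      (fun x => ccross (u x) (cgrad χ x)) s) atTop (𝓝 0) := by
  have hgrad : ∀ᶠ x in 𝓝 x₀, cgrad χ x = 0 := by
    filter_upwards [hχ1.eventuallyEq_nhds] with x hx
    ext i
    simp [cgrad, hx.fderiv_eq]
  obtain ⟨r, hr, hball⟩ := Metric.eventually_nhds_iff_ball.1 hgrad
  refine tendsto_pow_smul_laplaceIntegral_of_re_le_neg
    (integrable_ccross_of_hasCompactSupport hu (continuous_cgrad hχ (by simp))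
      (hasCompactSupport_cgrad hχc)) (mul_pos hc hr) ?_ n
  filter_upwards [ae_restrict_mem hΩ] with x hx hne
  have hrx : r ≤ ‖x - x₀‖ := by
    by_contra! hlt
    exact hne (by rw [hball x (mem_ball_iff_norm.2 hlt), map_zero])
  linarith [hℓ x hx, mul_le_mul_of_nonneg_left hrx hc.le]

theorem tendsto_pow_three_smul_laplaceIntegral_smul (hΩ : MeasurableSet Ω) (hK : MeasurableSet K)
    (hΩK : IsConicalAt Ω K x₀) (hc : 0 < c) (hℓ : ∀ y ∈ K, (linearPhase ρ y).re ≤ -(c * ‖y‖))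
    (hJ2 : MemLp J 2 (volume.restrict Ω)) (hJ : ContinuousWithinAt J Ω x₀)
    (hχ : Continuous χ) (hχc : HasCompactSupport χ) (hχ1 : χ =ᶠ[𝓝 x₀] 1) :
    Tendsto (fun s : ℝ => (s : ℂ) ^ 3 •
      laplaceIntegral (volume.restrict Ω) (linearPhase ρ) x₀ (χ • J) s) atTop
      (𝓝 ((∫ y in K, Complex.exp (linearPhase ρ y)) • J x₀)) := by
  have hL : Tendsto (χ • J) (𝓝[Ω] x₀) (𝓝 (J x₀)) := by
    have hsmul := (hχ.continuousWithinAt (s := Ω) (x := x₀)).smul hJ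
    rwa [ContinuousWithinAt, Pi.smul_apply', hχ1.eq_of_nhds, Pi.one_apply, one_smul] at hsmul
  have hlim := tendsto_pow_smul_laplaceIntegral hΩ hK hΩK hc hℓ
    (integrable_smul_of_hasCompactSupport hJ2 hχ hχc) hL
  rwa [finrank_euclideanSpace_fin, integral_smul_const] at hlim

theorem ccross_laplaceIntegral_add_eq (hΩ : MeasurableSet Ω)
    (hu : MemHCurl Ω u) (hΓ : TangentialTraceVanishesOn Ω Γ u)
    (hv : MemLp v 2 (volume.restrict Ω)) (hJ : MemLp J 2 (volume.restrict Ω))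
    (h : weakCurl Ω u =ᵐ[volume.restrict Ω] m • v + J)
    (hχ : ContDiff ℝ (⊤ : ℕ∞) χ) (hχc : HasCompactSupport χ)
    (hχΓ : Disjoint (tsupport χ) (frontier Ω \ Γ))
    (hℓ : ∀ x ∈ Ω, (linearPhase ρ (x - x₀)).re ≤ 0) {s : ℝ} (hs : 0 ≤ s) :
    (s : ℂ) • ccross (laplaceIntegral (volume.restrict Ω) (linearPhase ρ) x₀ (χ • u) s) ρ +
        laplaceIntegral (volume.restrict Ω) (linearPhase ρ) x₀
          (fun x => ccross (u x) (cgrad χ x)) s =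
      m • laplaceIntegral (volume.restrict Ω) (linearPhase ρ) x₀ (χ • v) s +
        laplaceIntegral (volume.restrict Ω) (linearPhase ρ) x₀ (χ • J) s := by
  have hχv := integrable_smul_of_hasCompactSupport hv hχ.continuous hχc
  have hχJ := integrable_smul_of_hasCompactSupport hJ hχ.continuous hχc
  rw [← laplaceIntegral_smul_weakCurl hu hΓ hχ hχc hχΓ, ← laplaceIntegral_const_smul,
    ← laplaceIntegral_add (hχv.smul m) hχJ (by filter_upwards [ae_restrict_mem hΩ] using hℓ) hs]
  refine integral_congr_ae ?_
  filter_upwards [h] with x hx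
  simp only [Pi.smul_apply', Pi.add_apply, Pi.smul_apply, hx, smul_add, smul_comm m]

theorem MemHCurl.memLp_source (hu : MemHCurl Ω u) (hv : MemLp v 2 (volume.restrict Ω))
    (h : weakCurl Ω u =ᵐ[volume.restrict Ω] m • v + J) : MemLp J 2 (volume.restrict Ω) := by
  refine (hu.isWeakCurl_weakCurl.2.1.sub (hv.const_smul m)).ae_eq ?_
  filter_upwards [h] with x hx
  simp [hx]

theorem bdot_source_eq_zero (hΩ : MeasurableSet Ω) (hK : MeasurableSet K)
    (hΩK : IsConicalAt Ω K x₀) (hΓ : (frontier Ω \ Γ)ᶜ ∈ 𝓝 x₀) (hc : 0 < c)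
    (hℓ : ∀ y ∈ K, (linearPhase ρ y).re ≤ -(c * ‖y‖)) (hρ : bdot ρ ρ = 0)
    (hI : ∫ y in K, Complex.exp (linearPhase ρ y) ≠ 0) (hu : MemHCurl Ω u) (hv : MemHCurl Ω v)
    (hu_tr : TangentialTraceVanishesOn Ω Γ u) (hv_tr : TangentialTraceVanishesOn Ω Γ v)
    (h₁ : weakCurl Ω u =ᵐ[volume.restrict Ω] m • v + J)
    (h₂ : weakCurl Ω v =ᵐ[volume.restrict Ω] n • u + J')
    (hJ : ContinuousWithinAt J Ω x₀) (hJ' : ContinuousWithinAt J' Ω x₀) :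
    bdot (J x₀) ρ = 0 := by
  obtain ⟨χ, hχ, hχc, hχU, hχ1⟩ := exists_contDiff_tsupport_subset_eventuallyEq_one hΓ
  have hχΓ : Disjoint (tsupport χ) (frontier Ω \ Γ) := disjoint_compl_left.mono_left hχU
  have hu2 := hu.isWeakCurl_weakCurl.1
  have hv2 := hv.isWeakCurl_weakCurl.1
  have hJ2 := hu.memLp_source hv2 h₁
  have hJ2' := hv.memLp_source hu2 h₂
  have hℓΩ : ∀ x ∈ Ω, (linearPhase ρ (x - x₀)).re ≤ -(c * ‖x - x₀‖) :=
    fun x hx => hℓ _ (hΩK.sub_mem x hx)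
  have hℓ0 : ∀ x ∈ Ω, (linearPhase ρ (x - x₀)).re ≤ 0 :=
    fun x hx => (hℓΩ x hx).trans (neg_nonpos.2 (by positivity))
  have hnil (z : C3) : ccross.flip ρ (ccross.flip ρ (ccross.flip ρ z)) = 0 :=
    (ccross_ccross_self hρ (ccross z ρ)).trans (by rw [bdot_ccross_self, zero_smul])
  have hzero := apply_apply_eq_zero_of_tendsto hnil
    ((eventually_ge_atTop 0).mono fun s hs =>
      ccross_laplaceIntegral_add_eq (x₀ := x₀) hΩ hu hu_tr hv2 hJ2 h₁ hχ hχc hχΓ hℓ0 hs)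
    ((eventually_ge_atTop 0).mono fun s hs =>
      ccross_laplaceIntegral_add_eq hΩ hv hv_tr hu2 hJ2' h₂ hχ hχc hχΓ hℓ0 hs)
    (tendsto_pow_smul_laplaceIntegral_of_memLp_two hΩ
      (memLp_smul_of_hasCompactSupport hv2 hχ.continuous hχc) hc hℓΩ (by simp))
    (tendsto_pow_three_smul_laplaceIntegral_smul hΩ hK hΩK hc hℓ hJ2 hJ hχ.continuous hχc hχ1)
    (tendsto_pow_three_smul_laplaceIntegral_smul hΩ hK hΩK hc hℓ hJ2' hJ' hχ.continuous hχc hχ1)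
    (tendsto_pow_smul_laplaceIntegral_ccross_cgrad hΩ hu2 hχ hχc hχ1 hc hℓΩ 3)
    (tendsto_pow_smul_laplaceIntegral_ccross_cgrad hΩ hv2 hχ hχc hχ1 hc hℓΩ 3)
  simp only [map_smul, ContinuousLinearMap.flip_apply, ccross_ccross_self hρ] at hzero
  rcases smul_eq_zero.1 ((smul_eq_zero.1 hzero).resolve_left hI) with h | rfl
  · exact h
  · simp [bdot]

end CurlSystem

section PlanarIntegral

variable {m : ℝ}

theorem integrableOn_Ioi_mul_exp_neg_mul (hm : 0 < m) :
    IntegrableOn (fun r : ℝ => r * Real.exp (-(m * r))) (Ioi 0) := by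
  have h := integrableOn_rpow_mul_exp_neg_mul_rpow (p := 1) (s := 1) (b := m) (by norm_num)
    one_pos hm
  simpa only [Real.rpow_one, neg_mul] using h

theorem tendsto_pow_mul_cexp_neg_mul_atTop {w : ℂ} (hw : 0 < w.re) (n : ℕ) :
    Tendsto (fun r : ℝ => (r : ℂ) ^ n * Complex.exp (-(w * r))) atTop (𝓝 0) := by
  rw [tendsto_zero_iff_norm_tendsto_zero]
  refine (tendsto_rpow_mul_exp_neg_mul_atTop_nhds_zero n w.re hw).congr' ?_
  filter_upwards [eventually_ge_atTop 0] with r hr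
  simp [Complex.norm_exp, abs_of_nonneg hr]

theorem integral_Ioi_mul_cexp_neg_mul {w : ℂ} (hw : 0 < w.re) :
    ∫ r in Ioi (0 : ℝ), (r : ℂ) * Complex.exp (-(w * r)) = 1 / w ^ 2 := by
  have hw0 : w ≠ 0 := fun h => by simp [h] at hw
  set F : ℝ → ℂ := fun r => -w⁻¹ * (r * Complex.exp (-(w * r))) -
    (w ^ 2)⁻¹ * Complex.exp (-(w * r)) with hF
  have hderiv (r : ℝ) : HasDerivAt F (r * Complex.exp (-(w * r))) r := by
    have hid : HasDerivAt (fun r : ℝ => (r : ℂ)) 1 r := Complex.ofRealCLM.hasDerivAt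
    have hexp := (hid.const_mul w).fun_neg.cexp
    refine (((hid.fun_mul hexp).const_mul (-w⁻¹)).fun_sub
      (hexp.const_mul (w ^ 2)⁻¹)).congr_deriv ?_
    field_simp
    ring
  have hlim : Tendsto F atTop (𝓝 0) := by
    simpa [hF] using ((tendsto_pow_mul_cexp_neg_mul_atTop hw 1).const_mul (-w⁻¹)).sub
      ((tendsto_pow_mul_cexp_neg_mul_atTop hw 0).const_mul (w ^ 2)⁻¹)
  have hint : IntegrableOn (fun r : ℝ => (r : ℂ) * Complex.exp (-(w * r))) (Ioi 0) := by
    refine Integrable.mono' (integrableOn_Ioi_mul_exp_neg_mul hw) (by fun_prop) ?_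
    filter_upwards [ae_restrict_mem measurableSet_Ioi] with r hr
    simp [Complex.norm_exp, abs_of_pos (mem_Ioi.1 hr)]
  rw [integral_Ioi_of_hasDerivAt_of_tendsto' (fun r _ => hderiv r) hint hlim]
  simp [hF]

theorem re_one_div_sub_I_mul_cos_sq (hm : 0 < m) (θ : ℝ) :
    (1 / ((m : ℂ) - Complex.I * Real.cos θ) ^ 2).re =
      m ^ 2 / (m ^ 2 + 1) * (1 / (m ^ 2 + Real.cos θ ^ 2)) +
        -1 / (m ^ 2 + 1) *
          ((Real.cos θ ^ 2 * (2 * m ^ 2 + 1) - m ^ 2) / (m ^ 2 + Real.cos θ ^ 2) ^ 2) := by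
  have hsq : ((m : ℂ) - Complex.I * Real.cos θ) ^ 2 =
      ((m ^ 2 - Real.cos θ ^ 2 : ℝ) : ℂ) + ((-2 * m * Real.cos θ : ℝ) : ℂ) * Complex.I := by
    push_cast
    linear_combination (Complex.cos θ) ^ 2 * Complex.I_sq
  have hnormSq : Complex.normSq (((m ^ 2 - Real.cos θ ^ 2 : ℝ) : ℂ) +
      ((-2 * m * Real.cos θ : ℝ) : ℂ) * Complex.I) = (m ^ 2 + Real.cos θ ^ 2) ^ 2 := by
    rw [Complex.normSq_add_mul_I]
    ring
  rw [hsq, one_div, Complex.inv_re, hnormSq, Complex.add_re, Complex.ofReal_re,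
    Complex.re_ofReal_mul, Complex.I_re]
  have hden : m ^ 2 + Real.cos θ ^ 2 ≠ 0 := by positivity
  field_simp
  ring

theorem integral_deriv_sin_mul_cos_div_eq_zero (hm : 0 < m) :
    ∫ θ in (-Real.pi)..Real.pi,
      (Real.cos θ ^ 2 * (2 * m ^ 2 + 1) - m ^ 2) / (m ^ 2 + Real.cos θ ^ 2) ^ 2 = 0 := by
  have hden (θ : ℝ) : m ^ 2 + Real.cos θ ^ 2 ≠ 0 := by positivity
  have hderiv (θ : ℝ) : HasDerivAt (fun θ => Real.sin θ * Real.cos θ / (m ^ 2 + Real.cos θ ^ 2))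
      ((Real.cos θ ^ 2 * (2 * m ^ 2 + 1) - m ^ 2) / (m ^ 2 + Real.cos θ ^ 2) ^ 2) θ := by
    refine (((Real.hasDerivAt_sin θ).fun_mul (Real.hasDerivAt_cos θ)).fun_div
      (((Real.hasDerivAt_cos θ).fun_pow 2).const_add (m ^ 2)) (hden θ)).congr_deriv ?_
    congr 1
    push_cast
    linear_combination (Real.cos θ ^ 2 - m ^ 2) * Real.sin_sq_add_cos_sq θ
  rw [intervalIntegral.integral_eq_sub_of_hasDerivAt fun θ _ => hderiv θ]
  · simp
  · refine Continuous.intervalIntegrable ?_ _ _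
    exact Continuous.div (by fun_prop) (by fun_prop) fun θ => pow_ne_zero 2 (hden θ)

theorem integral_one_div_sub_I_mul_cos_sq_ne_zero (hm : 0 < m) :
    ∫ θ in Ioo (-Real.pi) Real.pi, 1 / ((m : ℂ) - Complex.I * Real.cos θ) ^ 2 ≠ 0 := by
  have hden (θ : ℝ) : 0 < m ^ 2 + Real.cos θ ^ 2 := by positivity
  have hne (θ : ℝ) : (m : ℂ) - Complex.I * Real.cos θ ≠ 0 := fun h =>
    hm.ne' (by simpa using congrArg Complex.re h)
  have hcont : Continuous fun θ : ℝ => 1 / ((m : ℂ) - Complex.I * Real.cos θ) ^ 2 :=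
    continuous_const.div (by fun_prop) fun θ => pow_ne_zero 2 (hne θ)
  have hcont₁ : Continuous fun θ : ℝ => 1 / (m ^ 2 + Real.cos θ ^ 2) :=
    continuous_const.div (by fun_prop) fun θ => (hden θ).ne'
  have hcont₂ : Continuous fun θ : ℝ =>
      (Real.cos θ ^ 2 * (2 * m ^ 2 + 1) - m ^ 2) / (m ^ 2 + Real.cos θ ^ 2) ^ 2 :=
    Continuous.div (by fun_prop) (by fun_prop) fun θ => pow_ne_zero 2 (hden θ).ne'
  have hre : (∫ θ in (-Real.pi)..Real.pi, 1 / ((m : ℂ) - Complex.I * Real.cos θ) ^ 2).re =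
      m ^ 2 / (m ^ 2 + 1) * ∫ θ in (-Real.pi)..Real.pi, 1 / (m ^ 2 + Real.cos θ ^ 2) := by
    rw [← Complex.reCLM_apply,
      ← Complex.reCLM.intervalIntegral_comp_comm (hcont.intervalIntegrable _ _)]
    simp only [Complex.reCLM_apply, re_one_div_sub_I_mul_cos_sq hm]
    rw [intervalIntegral.integral_add ((hcont₁.const_mul _).intervalIntegrable _ _)
      ((hcont₂.const_mul _).intervalIntegrable _ _), intervalIntegral.integral_const_mul,
      intervalIntegral.integral_const_mul, integral_deriv_sin_mul_cos_div_eq_zero hm, mul_zero,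
      add_zero]
  have hpos : 0 < ∫ θ in (-Real.pi)..Real.pi, 1 / (m ^ 2 + Real.cos θ ^ 2) :=
    intervalIntegral.intervalIntegral_pos_of_pos (hcont₁.intervalIntegrable _ _)
      (fun θ => one_div_pos.2 (hden θ)) (by linarith [Real.pi_pos])
  rw [← integral_Ioc_eq_integral_Ioo, ← intervalIntegral.integral_of_le (by linarith [Real.pi_pos])]
  intro h
  rw [h, Complex.zero_re] at hre
  exact (mul_pos (by positivity) hpos).ne hre

theorem integrableOn_polar_mul_cexp_neg_mul (hm : 0 < m) :
    IntegrableOn (fun p : ℝ × ℝ => (p.1 : ℂ) *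
      Complex.exp (-(((m : ℂ) - Complex.I * Real.cos p.2) * p.1)))
      (Ioi 0 ×ˢ Ioo (-Real.pi) Real.pi) := by
  have hbound := Integrable.mul_prod (integrableOn_Ioi_mul_exp_neg_mul hm)
    (integrableOn_const (by simp) : IntegrableOn (fun _ : ℝ => (1 : ℝ)) (Ioo (-Real.pi) Real.pi))
  rw [Measure.prod_restrict] at hbound
  refine Integrable.mono' hbound (by fun_prop) ?_
  filter_upwards [ae_restrict_mem (measurableSet_Ioi.prod measurableSet_Ioo)] with p hp
  have hr : (0 : ℝ) < p.1 := hp.1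
  simp [Complex.norm_exp, abs_of_pos hr]

theorem integral_cexp_neg_mul_sqrt_add_I_mul (hm : 0 < m) :
    ∫ q : ℝ × ℝ, Complex.exp (-(m * √(q.1 ^ 2 + q.2 ^ 2) : ℝ) + Complex.I * q.1) =
      ∫ θ in Ioo (-Real.pi) Real.pi, 1 / ((m : ℂ) - Complex.I * Real.cos θ) ^ 2 := by
  have hradial (θ : ℝ) : ∫ r in Ioi (0 : ℝ),
      (r : ℂ) * Complex.exp (-(((m : ℂ) - Complex.I * Real.cos θ) * r)) =
        1 / ((m : ℂ) - Complex.I * Real.cos θ) ^ 2 :=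
    integral_Ioi_mul_cexp_neg_mul (by simpa using hm)
  have hint := integrableOn_polar_mul_cexp_neg_mul hm
  rw [← integral_comp_polarCoord_symm]
  calc _ = ∫ p in Ioi (0 : ℝ) ×ˢ Ioo (-Real.pi) Real.pi, (p.1 : ℂ) *
      Complex.exp (-(((m : ℂ) - Complex.I * Real.cos p.2) * p.1)) := by
        refine setIntegral_congr_fun (measurableSet_Ioi.prod measurableSet_Ioo) ?_
        rintro ⟨r, θ⟩ ⟨hr, -⟩
        have hnorm : √((r * Real.cos θ) ^ 2 + (r * Real.sin θ) ^ 2) = r := by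
          rw [mul_pow, mul_pow, ← mul_add, Real.cos_sq_add_sin_sq, mul_one,
            Real.sqrt_sq (mem_Ioi.1 hr).le]
        simp only [polarCoord_symm_apply, hnorm, Complex.real_smul]
        congr 2
        push_cast
        ring
    _ = _ := by
        rw [Measure.volume_eq_prod] at hint ⊢
        rw [← setIntegral_prod_swap, setIntegral_prod]
        · simp only [Prod.swap_prod_mk, hradial]
        · exact hint.swap

end PlanarIntegral

section ConeIntegral

theorem mul_sqrt_sq_add_lt_iff {c s z w : ℝ} (hc : 0 < c) (hs : 0 < s) (hcs : c ^ 2 + s ^ 2 = 1)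
    (hw : 0 ≤ w) : c * √(z ^ 2 + w) < z ↔ c / s * √w < z := by
  have hsq (hz : 0 < z) : c * √(z ^ 2 + w) < z ↔ c / s * √w < z := by
    rw [← pow_lt_pow_iff_left₀ (by positivity) hz.le two_ne_zero,
      ← pow_lt_pow_iff_left₀ (a := c / s * √w) (by positivity) hz.le two_ne_zero,
      mul_pow, mul_pow, Real.sq_sqrt (by positivity), Real.sq_sqrt hw, div_pow, div_mul_eq_mul_div,
      div_lt_iff₀ (by positivity), eq_sub_of_add_eq' hcs]
    constructor <;> intro h <;> linarith
  exact ⟨fun h => (hsq (lt_of_le_of_lt (by positivity) h)).1 h,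
    fun h => (hsq (lt_of_le_of_lt (by positivity) h)).2 h⟩

/-- The coordinates of a point of `ℝ³` in an orthonormal basis, the first one set apart. -/
noncomputable def orthonormalCoords (B : OrthonormalBasis (Fin 3) ℝ R3) : R3 ≃ᵐ ℝ × ℝ × ℝ :=
  (B.repr.toHomeomorph.toMeasurableEquiv.trans (MeasurableEquiv.toLp 2 (Fin 3 → ℝ)).symm).trans
    ((MeasurableEquiv.piFinSuccAbove (fun _ => ℝ) 0).trans
      ((MeasurableEquiv.refl ℝ).prodCongr MeasurableEquiv.finTwoArrow))

theorem orthonormalCoords_apply (B : OrthonormalBasis (Fin 3) ℝ R3) (y : R3) :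
    orthonormalCoords B y = (inner ℝ (B 0) y, inner ℝ (B 1) y, inner ℝ (B 2) y) := by
  simp only [← B.repr_apply_apply]
  rfl

theorem measurePreserving_orthonormalCoords (B : OrthonormalBasis (Fin 3) ℝ R3) :
    MeasurePreserving (orthonormalCoords B) :=
  ((MeasurePreserving.id volume).prod (volume_preserving_finTwoArrow ℝ)).comp
    ((volume_preserving_piFinSuccAbove (fun _ : Fin 3 => ℝ) 0).comp
      ((EuclideanSpace.volume_preserving_symm_measurableEquiv_toLp (Fin 3)).comp
        B.measurePreserving_repr))

theorem setOf_mul_norm_lt_inner_eq_preimage (B : OrthonormalBasis (Fin 3) ℝ R3) {c s : ℝ}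
    (hc : 0 < c) (hs : 0 < s) (hcs : c ^ 2 + s ^ 2 = 1) :
    {y : R3 | c * ‖y‖ < inner ℝ (B 0) y} =
      orthonormalCoords B ⁻¹' {p | c / s * √(p.2.1 ^ 2 + p.2.2 ^ 2) < p.1} := by
  ext y
  have hnorm : ‖y‖ = √(inner ℝ (B 0) y ^ 2 + (inner ℝ (B 1) y ^ 2 + inner ℝ (B 2) y ^ 2)) := by
    rw [← B.repr.norm_map y, EuclideanSpace.norm_eq]
    simp [Fin.sum_univ_three, B.repr_apply_apply, add_assoc]
  simp only [mem_ofPred_eq, mem_preimage, orthonormalCoords_apply]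
  rw [hnorm]
  exact mul_sqrt_sq_add_lt_iff hc hs hcs (by positivity)

theorem setIntegral_cexp_neg_add_I_mul_eq {m : ℝ}
    (hint : IntegrableOn (fun p : ℝ × ℝ × ℝ => Complex.exp (-p.1 + Complex.I * p.2.1))
      {p | m * √(p.2.1 ^ 2 + p.2.2 ^ 2) < p.1}) :
    ∫ p in {p : ℝ × ℝ × ℝ | m * √(p.2.1 ^ 2 + p.2.2 ^ 2) < p.1},
        Complex.exp (-p.1 + Complex.I * p.2.1) =
      ∫ q : ℝ × ℝ, Complex.exp (-(m * √(q.1 ^ 2 + q.2 ^ 2) : ℝ) + Complex.I * q.1) := by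
  have hS : MeasurableSet {p : ℝ × ℝ × ℝ | m * √(p.2.1 ^ 2 + p.2.2 ^ 2) < p.1} :=
    measurableSet_lt (by fun_prop) (by fun_prop)
  rw [← integrable_indicator_iff hS, Measure.volume_eq_prod] at hint
  rw [← integral_indicator hS, Measure.volume_eq_prod, integral_prod_symm _ hint]
  congr 1 with q
  have hfiber : (fun z : ℝ => indicator {p : ℝ × ℝ × ℝ | m * √(p.2.1 ^ 2 + p.2.2 ^ 2) < p.1}
      (fun p => Complex.exp (-p.1 + Complex.I * p.2.1)) (z, q)) =
      (Ioi (m * √(q.1 ^ 2 + q.2 ^ 2))).indicator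
        (fun z => ((Real.exp (-z) : ℝ) : ℂ) * Complex.exp (Complex.I * q.1)) := by
    funext z
    simp only [indicator, mem_ofPred_eq, mem_Ioi, Complex.exp_add, Complex.ofReal_exp,
      Complex.ofReal_neg]
  rw [hfiber, integral_indicator measurableSet_Ioi, integral_mul_const, integral_complex_ofReal,
    integral_exp_neg_Ioi, Complex.exp_add, Complex.ofReal_exp, Complex.ofReal_neg]

theorem setIntegral_cone_cexp_ne_zero (B : OrthonormalBasis (Fin 3) ℝ R3) {c s : ℝ}
    (hc : 0 < c) (hs : 0 < s) (hcs : c ^ 2 + s ^ 2 = 1) :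
    ∫ y in {y : R3 | c * ‖y‖ < inner ℝ (B 0) y},
      Complex.exp (-(inner ℝ (B 0) y : ℝ) + Complex.I * (inner ℝ (B 1) y : ℝ)) ≠ 0 := by
  set g : ℝ × ℝ × ℝ → ℂ := fun p => Complex.exp (-p.1 + Complex.I * p.2.1)
  have hB := measurePreserving_orthonormalCoords B
  have hg (y : R3) : Complex.exp (-(inner ℝ (B 0) y : ℝ) + Complex.I * (inner ℝ (B 1) y : ℝ)) =
      g (orthonormalCoords B y) := by
    rw [orthonormalCoords_apply]
  have hmeas : MeasurableSet {y : R3 | c * ‖y‖ < inner ℝ (B 0) y} :=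
    measurableSet_lt (by fun_prop) (by fun_prop)
  have hint : IntegrableOn g {p | c / s * √(p.2.1 ^ 2 + p.2.2 ^ 2) < p.1} := by
    rw [← hB.integrableOn_comp_preimage (orthonormalCoords B).measurableEmbedding,
      ← setOf_mul_norm_lt_inner_eq_preimage B hc hs hcs]
    refine Integrable.mono' (integrable_exp_neg_mul_norm volume hc).integrableOn
      (Measurable.aestronglyMeasurable (by fun_prop)) ?_
    filter_upwards [ae_restrict_mem hmeas] with y hy
    rw [Function.comp_apply, ← hg, Complex.norm_exp, Real.exp_le_exp]
    simpa using le_of_lt hy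
  simp only [hg]
  rw [setOf_mul_norm_lt_inner_eq_preimage B hc hs hcs,
    hB.setIntegral_preimage_emb (orthonormalCoords B).measurableEmbedding,
    setIntegral_cexp_neg_add_I_mul_eq hint,
    integral_cexp_neg_mul_sqrt_add_I_mul (div_pos hc hs)]
  exact integral_one_div_sub_I_mul_cos_sq_ne_zero (div_pos hc hs)

end ConeIntegral

section WaveVector

theorem linearPhase_apply (ρ : C3) (y : R3) : linearPhase ρ y = ∑ i, y i * ρ i := by
  simp [linearPhase]

/-- The wave vector `-a + i b ∈ ℂ³`, which is null when `a` and `b` are orthonormal. -/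
noncomputable def waveVector (a b : R3) : C3 :=
  WithLp.toLp 2 fun i => -a i + Complex.I * b i

variable {a b : R3}

theorem linearPhase_waveVector (a b y : R3) :
    linearPhase (waveVector a b) y = -(inner ℝ a y : ℝ) + Complex.I * (inner ℝ b y : ℝ) := by
  simp only [waveVector, linearPhase_apply, Fin.sum_univ_three, PiLp.inner_apply,
    RCLike.inner_apply, Real.ringHom_apply, Complex.ofReal_add, Complex.ofReal_mul]
  ring

theorem bdot_waveVector (z : C3) (a b : R3) :
    bdot z (waveVector a b) = -linearPhase z a + Complex.I * linearPhase z b := by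
  simp only [bdot, waveVector, Fin.sum_univ_three, linearPhase_apply]
  ring

theorem bdot_waveVector_self (ha : ‖a‖ = 1) (hb : ‖b‖ = 1) (hab : inner ℝ a b = 0) :
    bdot (waveVector a b) (waveVector a b) = 0 := by
  have hba : inner ℝ b a = 0 := by rw [real_inner_comm, hab]
  simp only [bdot_waveVector, linearPhase_waveVector, hab, hba, real_inner_self_eq_norm_sq, ha, hb]
  push_cast
  linear_combination Complex.I_sq

theorem exists_orthonormalBasis_apply_zero_eq (ha : ‖a‖ = 1) :
    ∃ B : OrthonormalBasis (Fin 3) ℝ R3, B 0 = a := by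
  have hon : Orthonormal ℝ (({0} : Set (Fin 3)).domRestrict fun _ => a) := by
    rw [orthonormal_iff_ite]
    rintro ⟨i, rfl⟩ ⟨j, rfl⟩
    simp [ha]
  obtain ⟨B, hB⟩ := hon.exists_orthonormalBasis_extension_of_card_eq (by simp)
  exact ⟨B, hB 0 rfl⟩

theorem exists_orthonormalBasis_apply_eq_pair (ha : ‖a‖ = 1) (hb : ‖b‖ = 1)
    (hab : inner ℝ a b = 0) : ∃ B : OrthonormalBasis (Fin 3) ℝ R3, B 0 = a ∧ B 1 = b := by
  have hon : Orthonormal ℝ (({0, 1} : Set (Fin 3)).domRestrict ![a, b, 0]) := by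
    rw [orthonormal_iff_ite]
    rintro ⟨i, rfl | rfl⟩ ⟨j, rfl | rfl⟩ <;> simp [ha, hb, hab, real_inner_comm, Subtype.ext_iff]
  obtain ⟨B, hB⟩ := hon.exists_orthonormalBasis_extension_of_card_eq (by simp)
  exact ⟨B, hB 0 (by simp), hB 1 (by simp)⟩

theorem eq_zero_of_forall_bdot_waveVector_eq_zero (ha : ‖a‖ = 1) {z : C3}
    (h : ∀ b : R3, ‖b‖ = 1 → inner ℝ a b = 0 → bdot z (waveVector a b) = 0) : z = 0 := by
  obtain ⟨B, rfl⟩ := exists_orthonormalBasis_apply_zero_eq ha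
  have horth (k : Fin 3) (hk : k ≠ 0) : inner ℝ (B 0) (B k) = 0 := B.orthonormal.2 hk.symm
  have hwave (b : R3) (hb : ‖b‖ = 1) (hab : inner ℝ (B 0) b = 0) :
      -linearPhase z (B 0) + Complex.I * linearPhase z b = 0 :=
    (bdot_waveVector z _ b).symm.trans (h b hb hab)
  have hzero : linearPhase z (B 0) = 0 := by
    have hpos := hwave (B 1) (B.norm_eq_one 1) (horth 1 (by decide))
    have hneg := hwave (-B 1) (by rw [norm_neg, B.norm_eq_one])
      (by rw [inner_neg_right, horth 1 (by decide), neg_zero])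
    rw [map_neg] at hneg
    linear_combination (-1 / 2) * (hpos + hneg)
  have hphase : (linearPhase z : R3 →ₗ[ℝ] ℂ) = 0 := by
    refine B.toBasis.ext fun k => ?_
    rcases eq_or_ne k 0 with rfl | hk
    · simpa using hzero
    · simpa [hzero] using hwave (B k) (B.norm_eq_one k) (horth k hk)
  ext i
  simpa [linearPhase_single] using LinearMap.congr_fun hphase (EuclideanSpace.single i 1)

end WaveVector

section CircularCone

variable {x₀ a b : R3} {θ₀ r₀ : ℝ}

theorem mem_circularCone_iff (ha : ‖a‖ = 1) (hθ₀ : θ₀ ∈ Ioo 0 (Real.pi / 2)) {x : R3} :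
    x ∈ circularCone x₀ a θ₀ ↔ Real.cos θ₀ * ‖x - x₀‖ < inner ℝ a (x - x₀) := by
  rw [circularCone, mem_ofPred_eq]
  rcases eq_or_ne (x - x₀) 0 with hx | hx
  · simp [hx, hθ₀.2.le]
  · have hcos := InnerProductGeometry.cos_angle_mul_norm_mul_norm (x - x₀) a
    rw [ha, mul_one] at hcos
    rw [real_inner_comm, ← hcos, mul_lt_mul_iff_left₀ (norm_pos_iff.2 hx)]
    exact (Real.strictAntiOn_cos.lt_iff_gt ⟨hθ₀.1.le, by linarith [hθ₀.2, Real.pi_pos]⟩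
      ⟨InnerProductGeometry.angle_nonneg _ _, InnerProductGeometry.angle_le_pi _ _⟩).symm

theorem circularCone_eq_setOf (ha : ‖a‖ = 1) (hθ₀ : θ₀ ∈ Ioo 0 (Real.pi / 2)) :
    circularCone x₀ a θ₀ = {x | Real.cos θ₀ * ‖x - x₀‖ < inner ℝ a (x - x₀)} :=
  Set.ext fun _ => mem_circularCone_iff ha hθ₀

theorem isOpen_circularCone (ha : ‖a‖ = 1) (hθ₀ : θ₀ ∈ Ioo 0 (Real.pi / 2)) :
    IsOpen (circularCone x₀ a θ₀) := by
  rw [circularCone_eq_setOf ha hθ₀]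
  exact isOpen_lt (by fun_prop) (by fun_prop)

theorem isConicalAt_truncatedCone (hr₀ : 0 < r₀) :
    IsConicalAt (truncatedCone x₀ a θ₀ r₀) (circularCone 0 a θ₀) x₀ where
  smul_mem t ht y hy := by
    simpa [circularCone, InnerProductGeometry.angle_smul_left_of_pos _ _ ht] using hy
  sub_mem x hx := by simpa [circularCone] using hx.1
  eventually_mem := by
    filter_upwards [Metric.ball_mem_nhds x₀ hr₀] with x hxr hx
    exact ⟨by simpa [circularCone] using hx, hxr⟩

theorem apex_mem_closure_truncatedCone (ha : ‖a‖ = 1) (hθ₀ : 0 < θ₀) (hr₀ : 0 < r₀) :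
    x₀ ∈ closure (truncatedCone x₀ a θ₀ r₀) := by
  have hlim : Tendsto (fun t : ℝ => x₀ + t • a) (𝓝[>] 0) (𝓝 x₀) := by
    refine (Continuous.tendsto' (by fun_prop) 0 x₀ ?_).mono_left nhdsWithin_le_nhds
    rw [zero_smul, add_zero]
  refine mem_closure_of_tendsto hlim ?_
  filter_upwards [Ioo_mem_nhdsGT hr₀] with t ht
  have ha0 : a ≠ 0 := fun h => by simp [h] at ha
  constructor
  · rwa [circularCone, mem_ofPred_eq, add_sub_cancel_left,
      InnerProductGeometry.angle_smul_left_of_pos _ _ ht.1, InnerProductGeometry.angle_self ha0]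
  · simpa [norm_smul, ha, abs_of_pos ht.1] using ht.2

theorem continuousWithinAt_apex_of_holderOnWith (ha : ‖a‖ = 1) (hθ₀ : 0 < θ₀) (hr₀ : 0 < r₀)
    {J : R3 → C3} {C α : ℝ≥0} (hα : 0 < α)
    (hJ : HolderOnWith C α J (closure (truncatedCone x₀ a θ₀ r₀))) :
    ContinuousWithinAt J (truncatedCone x₀ a θ₀ r₀) x₀ :=
  (hJ.continuousOn hα x₀ (apex_mem_closure_truncatedCone ha hθ₀ hr₀)).mono subset_closure

theorem compl_frontier_diff_lateralBoundary_mem_nhds (hr₀ : 0 < r₀) :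
    (frontier (truncatedCone x₀ a θ₀ r₀) \ lateralBoundary x₀ a θ₀ r₀)ᶜ ∈ 𝓝 x₀ := by
  filter_upwards [Metric.ball_mem_nhds x₀ hr₀] with x hx hxf
  exact hxf.2 ⟨hxf.1, (Metric.mem_ball.1 hx).ne⟩

theorem setIntegral_circularCone_cexp_ne_zero (ha : ‖a‖ = 1) (hb : ‖b‖ = 1)
    (hab : inner ℝ a b = 0) (hθ₀ : θ₀ ∈ Ioo 0 (Real.pi / 2)) :
    ∫ y in circularCone 0 a θ₀, Complex.exp (linearPhase (waveVector a b) y) ≠ 0 := by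
  simp only [circularCone_eq_setOf ha hθ₀, sub_zero, linearPhase_waveVector]
  obtain ⟨B, rfl, rfl⟩ := exists_orthonormalBasis_apply_eq_pair ha hb hab
  exact setIntegral_cone_cexp_ne_zero B
    (Real.cos_pos_of_mem_Ioo ⟨by linarith [hθ₀.1, Real.pi_pos], hθ₀.2⟩)
    (Real.sin_pos_of_pos_of_lt_pi hθ₀.1 (by linarith [hθ₀.2, Real.pi_pos]))
    (Real.cos_sq_add_sin_sq θ₀)

theorem source_apex_eq_zero (ha : ‖a‖ = 1) (hθ₀ : θ₀ ∈ Ioo 0 (Real.pi / 2)) (hr₀ : 0 < r₀)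
    {u v J J' : R3 → C3} {m n : ℂ}
    (hu : MemHCurl (truncatedCone x₀ a θ₀ r₀) u) (hv : MemHCurl (truncatedCone x₀ a θ₀ r₀) v)
    (hu_tr : TangentialTraceVanishesOn (truncatedCone x₀ a θ₀ r₀) (lateralBoundary x₀ a θ₀ r₀) u)
    (hv_tr : TangentialTraceVanishesOn (truncatedCone x₀ a θ₀ r₀) (lateralBoundary x₀ a θ₀ r₀) v)
    (h₁ : weakCurl (truncatedCone x₀ a θ₀ r₀) u
      =ᵐ[volume.restrict (truncatedCone x₀ a θ₀ r₀)] m • v + J)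
    (h₂ : weakCurl (truncatedCone x₀ a θ₀ r₀) v
      =ᵐ[volume.restrict (truncatedCone x₀ a θ₀ r₀)] n • u + J')
    (hJ : ContinuousWithinAt J (truncatedCone x₀ a θ₀ r₀) x₀)
    (hJ' : ContinuousWithinAt J' (truncatedCone x₀ a θ₀ r₀) x₀) : J x₀ = 0 := by
  refine eq_zero_of_forall_bdot_waveVector_eq_zero ha fun b hb hab => ?_
  have hdecay (y : R3) (hy : y ∈ circularCone 0 a θ₀) :
      (linearPhase (waveVector a b) y).re ≤ -(Real.cos θ₀ * ‖y‖) := by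
    rw [mem_circularCone_iff ha hθ₀, sub_zero] at hy
    simpa [linearPhase_waveVector] using hy.le
  exact bdot_source_eq_zero
    ((isOpen_circularCone ha hθ₀).measurableSet.inter measurableSet_ball)
    (isOpen_circularCone ha hθ₀).measurableSet (isConicalAt_truncatedCone hr₀)
    (compl_frontier_diff_lateralBoundary_mem_nhds hr₀)
    (Real.cos_pos_of_mem_Ioo ⟨by linarith [hθ₀.1, Real.pi_pos], hθ₀.2⟩) hdecay
    (bdot_waveVector_self ha hb hab) (setIntegral_circularCone_cexp_ne_zero ha hb hab hθ₀)
    hu hv hu_tr hv_tr h₁ h₂ hJ hJ'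

end CircularCone

theorem theorem2p1_general {x₀ a : R3} (ha : ‖a‖ = 1) {θ₀ r₀ : ℝ}
    (hθ₀ : θ₀ ∈ Ioo 0 (Real.pi / 2)) (hr₀ : 0 < r₀) {k₁ k₂ : ℂ} {J₁ J₂ E H : R3 → C3}
    (hJ₁ : ContinuousWithinAt J₁ (truncatedCone x₀ a θ₀ r₀) x₀)
    (hJ₂ : ContinuousWithinAt J₂ (truncatedCone x₀ a θ₀ r₀) x₀)
    (hE : MemHCurl (truncatedCone x₀ a θ₀ r₀) E) (hH : MemHCurl (truncatedCone x₀ a θ₀ r₀) H)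
    (h₁ : ∀ᵐ x ∂(volume.restrict (truncatedCone x₀ a θ₀ r₀)),
      weakCurl (truncatedCone x₀ a θ₀ r₀) E x - k₁ • H x = J₁ x)
    (h₂ : ∀ᵐ x ∂(volume.restrict (truncatedCone x₀ a θ₀ r₀)),
      weakCurl (truncatedCone x₀ a θ₀ r₀) H x + k₂ • E x = J₂ x)
    (htraceE : TangentialTraceVanishesOn (truncatedCone x₀ a θ₀ r₀)
      (lateralBoundary x₀ a θ₀ r₀) E)
    (htraceH : TangentialTraceVanishesOn (truncatedCone x₀ a θ₀ r₀)
      (lateralBoundary x₀ a θ₀ r₀) H) :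
    J₁ x₀ = 0 ∧ J₂ x₀ = 0 := by
  have hcurlE : weakCurl (truncatedCone x₀ a θ₀ r₀) E
      =ᵐ[volume.restrict (truncatedCone x₀ a θ₀ r₀)] k₁ • H + J₁ :=
    h₁.mono fun x hx => eq_add_of_sub_eq' hx
  have hcurlH : weakCurl (truncatedCone x₀ a θ₀ r₀) H
      =ᵐ[volume.restrict (truncatedCone x₀ a θ₀ r₀)] -k₂ • E + J₂ :=
    h₂.mono fun x hx => by
      rw [Pi.add_apply, ← hx, Pi.smul_apply, neg_smul, neg_add_cancel_comm_assoc]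
  exact ⟨source_apex_eq_zero ha hθ₀ hr₀ hE hH htraceE htraceH hcurlE hcurlH hJ₁ hJ₂,
    source_apex_eq_zero ha hθ₀ hr₀ hH hE htraceH htraceE hcurlH hcurlE hJ₂ hJ₁⟩

theorem theorem2p1 (x₀ a : R3) (ha : ‖a‖ = 1) (θ₀ r₀ : ℝ)
    (hθ₀ : θ₀ ∈ Set.Ioo 0 (Real.pi / 2)) (hr₀ : 0 < r₀)
    (ω ε₀ μ₀ : ℝ) (hω : 0 < ω) (hε₀ : 0 < ε₀) (hμ₀ : 0 < μ₀)
    (α : ℝ≥0) (hα₀ : 0 < α) (hα₁ : α < 1) (J₁ J₂ E H : R3 → C3)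
    (hJ₁ : ∃ C : ℝ≥0, HolderOnWith C α J₁ (closure (truncatedCone x₀ a θ₀ r₀)))
    (hJ₂ : ∃ C : ℝ≥0, HolderOnWith C α J₂ (closure (truncatedCone x₀ a θ₀ r₀)))
    (hE : MemHCurl (truncatedCone x₀ a θ₀ r₀) E)
    (hH : MemHCurl (truncatedCone x₀ a θ₀ r₀) H)
    (hMaxwell₁ : ∀ᵐ x ∂(volume.restrict (truncatedCone x₀ a θ₀ r₀)),
      weakCurl (truncatedCone x₀ a θ₀ r₀) E x - (Complex.I * ω * μ₀) • H x = J₁ x)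
    (hMaxwell₂ : ∀ᵐ x ∂(volume.restrict (truncatedCone x₀ a θ₀ r₀)),
      weakCurl (truncatedCone x₀ a θ₀ r₀) H x + (Complex.I * ω * ε₀) • E x = J₂ x)
    (htraceE : TangentialTraceVanishesOn (truncatedCone x₀ a θ₀ r₀)
      (lateralBoundary x₀ a θ₀ r₀) E)
    (htraceH : TangentialTraceVanishesOn (truncatedCone x₀ a θ₀ r₀)
      (lateralBoundary x₀ a θ₀ r₀) H) :
    J₁ x₀ = 0 ∧ J₂ x₀ = 0 := by
  exact theorem2p1_general ha hθ₀ hr₀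
    (continuousWithinAt_apex_of_holderOnWith ha hθ₀.1 hr₀ hα₀ hJ₁.choose_spec)
    (continuousWithinAt_apex_of_holderOnWith ha hθ₀.1 hr₀ hα₀ hJ₂.choose_spec)
    hE hH hMaxwell₁ hMaxwell₂ htraceE htraceH
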